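/- Let $A$ and $B$ be unital, simple, purely infinite $C^*$-algebras. If the groups $GL(A)$ and $GL(B)$ of invertible elements of $A$ and $B$ are isomorphic as abstract groups, then the groups $K_1(A)$ and $K_1(B)$ are isomorphic. Here a unital $C^*$-algebra (over $\mathbb{C}$) is simple if it is nonzero and has no closed two-sided ideals except $0$ and itself. A simple $C^*$-algebra is purely infinite if each of its nonzero hereditary $C^*$-subalgebras contains an infinite projection, that is, a projection $p$ for which there is an element $v$ with $v^*v=p$ and $vv^*\le p$, $vv^*\neq p$. For a unital $C^*$-algebra $C$, $K_1(C)=\varinjlim_n GL_n(C)/GL_n(C)_0$, where $GL_n(C)$ is the group of invertible elements of $M_n(C)$ with the norm topology, $GL_n(C)_0$ is the connected component of the identity in it, and the connecting maps are induced by $u\mapsto \mathrm{diag}(u,1)$. -/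

import Mathlib

section CStar

variable {A : Type*} [CStarAlgebra A]

/-- An element of a C*-algebra is positive if it has the form `x* x`. -/
def IsPositiveElem (a : A) : Prop := ∃ x : A, a = star x * x

/-- A hereditary C*-subalgebra: a norm-closed (not necessarily unital) *-subalgebra `H` such that
`0 ≤ a ≤ b` and `b ∈ H` imply `a ∈ H`. -/
def IsHereditaryCStarSubalgebra (H : NonUnitalStarSubalgebra ℂ A) : Prop :=
  IsClosed (H : Set A) ∧
    ∀ a b : A, IsPositiveElem a → IsPositiveElem (b - a) → b ∈ H → a ∈ H

/-- A projection `p` is infinite if it is Murray-von Neumann equivalent to a proper subprojection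
`q < p` of itself: `p = v* v` and `q = v v*` with `p q = q` and `q ≠ p`. -/
def IsInfiniteProjection (p : A) : Prop :=
  IsStarProjection p ∧
    ∃ v : A, star v * v = p ∧ p * (v * star v) = v * star v ∧ v * star v ≠ p

end CStar

/-- A unital C*-algebra is simple if it is nonzero and has no closed two-sided ideals
other than `0` and itself. -/
def IsSimpleCStarAlgebra (A : Type*) [CStarAlgebra A] : Prop :=
  Nontrivial A ∧ ∀ I : TwoSidedIdeal A, IsClosed (I : Set A) → I = ⊥ ∨ I = ⊤

/-- Pure infiniteness (of a simple C*-algebra): every nonzero hereditary C*-subalgebra contains an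
infinite projection. -/
def IsPurelyInfinite (A : Type*) [CStarAlgebra A] : Prop :=
  ∀ H : NonUnitalStarSubalgebra ℂ A, IsHereditaryCStarSubalgebra H → H ≠ ⊥ →
    ∃ p ∈ H, IsInfiniteProjection p

section Stabilization

variable {A : Type*}

/-- The block matrix `diag(M, 1)` of size `n ≥ m` obtained from a matrix `M` of size `m`. -/
def padOne [Zero A] [One A] (m n : ℕ) (M : Matrix (Fin m) (Fin m) A) :
    Matrix (Fin n) (Fin n) A :=
  Matrix.of fun i j =>
    if h : (i : ℕ) < m ∧ (j : ℕ) < m then M ⟨i, h.1⟩ ⟨j, h.2⟩ else if i = j then 1 else 0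

theorem padOne_one [Zero A] [One A] (m n : ℕ) :
    padOne m n (1 : Matrix (Fin m) (Fin m) A) = 1 := by
  ext i j
  simp only [padOne, Matrix.of_apply, Matrix.one_apply, Fin.ext_iff]
  split_ifs <;> simp_all

theorem padOne_mul [Semiring A] {m n : ℕ} (h : m ≤ n) (M N : Matrix (Fin m) (Fin m) A) :
    padOne m n (M * N) = padOne m n M * padOne m n N := by
  obtain ⟨d, rfl⟩ := Nat.exists_eq_add_of_le h
  have h1 : ∀ (i : Fin m) (x : Fin d), ¬ (i : ℕ) = m + x := fun i x => by omega
  have h2 : ∀ (i : Fin m) (x : Fin d), ¬ m + (x : ℕ) = i := fun i x => by omega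
  ext i j
  rw [Matrix.mul_apply, Fin.sum_univ_add]
  refine Fin.addCases (fun i => ?_) (fun i => ?_) i <;>
  refine Fin.addCases (fun j => ?_) (fun j => ?_) j <;>
  simp [padOne, Matrix.mul_apply, Fin.ext_iff, h1, h2]
  simp [← Fin.ext_iff]

theorem padOne_self [Zero A] [One A] (m : ℕ) (M : Matrix (Fin m) (Fin m) A) :
    padOne m m M = M := by
  ext i j
  simp [padOne]

theorem padOne_padOne [Zero A] [One A] {m n k : ℕ} (h : m ≤ n) (M : Matrix (Fin m) (Fin m) A) :
    padOne n k (padOne m n M) = padOne m k M := by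
  ext i j
  simp only [padOne, Matrix.of_apply, Fin.ext_iff]
  split_ifs <;> first | rfl | omega

/-- The group homomorphism `GL_m(A) → GL_n(A)`, `u ↦ diag(u, 1)`, for `m ≤ n`. -/
def glPad [Semiring A] {m n : ℕ} (h : m ≤ n) :
    (Matrix (Fin m) (Fin m) A)ˣ →* (Matrix (Fin n) (Fin n) A)ˣ :=
  Units.map { toFun := padOne m n, map_one' := padOne_one m n, map_mul' := padOne_mul h }

end Stabilization

section K1

/-- `GL_n(A)_0`: the connected component of the identity in the group `GL_n(A)` of invertible
`n × n` matrices. Matrices carry the entrywise topology, which is the norm topology of the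
C*-algebra `M_n(A)`. -/
def glZero (A : Type*) [CStarAlgebra A] (n : ℕ) : Subgroup (Matrix (Fin n) (Fin n) A)ˣ :=
  Subgroup.connectedComponentOfOne _

variable {A : Type*} [CStarAlgebra A]

theorem continuous_padOne (m n : ℕ) :
    Continuous (padOne m n : Matrix (Fin m) (Fin m) A → Matrix (Fin n) (Fin n) A) := by
  refine continuous_matrix fun i j => ?_
  simp only [padOne, Matrix.of_apply]
  split_ifs <;> fun_prop

instance glZero_normal (n : ℕ) : (glZero A n).Normal := by
  refine ⟨fun u hu g => ?_⟩
  have hc : Continuous fun x : (Matrix (Fin n) (Fin n) A)ˣ => g * x * g⁻¹ := by fun_prop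
  have := hc.image_connectedComponent_subset 1 ⟨u, hu, rfl⟩
  rwa [mul_one, mul_inv_cancel] at this

theorem glZero_le_comap {m n : ℕ} (h : m ≤ n) :
    glZero A m ≤ (glZero A n).comap (glPad h) := by
  intro u hu
  have hc : Continuous (glPad (A := A) h) := Continuous.units_map _ (continuous_padOne m n)
  have := hc.image_connectedComponent_subset 1 ⟨u, hu, rfl⟩
  rwa [map_one] at this

/-- The homomorphism `GL_m(A)/GL_m(A)_0 → GL_n(A)/GL_n(A)_0` induced by `u ↦ diag(u, 1)`. -/
def k1Map (A : Type*) [CStarAlgebra A] (m n : ℕ) (h : m ≤ n) :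
    (Matrix (Fin m) (Fin m) A)ˣ ⧸ glZero A m →* (Matrix (Fin n) (Fin n) A)ˣ ⧸ glZero A n :=
  QuotientGroup.map _ _ (glPad h) (glZero_le_comap h)

instance k1Map_directedSystem (A : Type*) [CStarAlgebra A] :
    DirectedSystem (fun n : ℕ => (Matrix (Fin n) (Fin n) A)ˣ ⧸ glZero A n)
      (fun i j h => k1Map A i j h) where
  map_self n x := by
    induction x using QuotientGroup.induction_on with
    | H u =>
      refine congrArg _ (Units.ext ?_)
      exact padOne_self n u.1
  map_map k n m hmn hnk x := by
    induction x using QuotientGroup.induction_on with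
    | H u =>
      refine congrArg _ (Units.ext ?_)
      exact padOne_padOne hmn u.1

/-- The group `K_1(A)` of a unital C*-algebra `A`: the direct limit of the groups
`GL_n(A)/GL_n(A)_0` along the maps `u ↦ diag(u, 1)`. The group operation is written
multiplicatively. -/
abbrev K1 (A : Type*) [CStarAlgebra A] : Type _ :=
  DirectLimit (fun n : ℕ => (Matrix (Fin n) (Fin n) A)ˣ ⧸ glZero A n) (k1Map A)

end K1

/-! For such an algebra `K1 A` is the abelianization of the invertible group `Aˣ`, an invariant of
the abstract group. The work lies in showing that the canonical map `Aˣ →* K1 A` is onto with kernel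
the commutator subgroup.

An isometry s gives an endomorphism φ_s(u) = s u s* + 1 - s s* of `Aˣ`. Isometries with orthogonal
ranges give conjugate endomorphisms, hence equal ones modulo commutators. Two such isometries exist
(`exists_isometries`), and a swindle makes φ_s(exp a) a product of commutators. Block elimination
spreads this to a neighbourhood of 1, so the commutator subgroup is open and contains the identity
component (`connectedComponentOfOne_le_commutator`).

Rows of orthogonal isometries compress M_n(A) into A. This gives surjectivity, and shows that φ_s(u)
lies in the identity component when u is trivial in `K1 A`. Pure infiniteness enters through
`exists_isometries_fixing`: s can be chosen, depending on u, so that u and φ_s(u) agree modulo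
commutators. Hence the kernel is the commutator subgroup. -/

open Filter Topology Matrix

/-! ### Corner embeddings of unit groups, and conjugation between orthogonal corners -/

section Corner

variable {R S : Type*} [Ring R] [Ring S]

/-- The monoid homomorphism `a ↦ θ a + (1 - θ 1)` attached to a non-unital ring homomorphism. -/
def cornerHom (θ : S →ₙ+* R) : S →* R where
  toFun a := θ a + (1 - θ 1)
  map_one' := by abel
  map_mul' a b := by
    have h1 : θ a * θ 1 = θ a := by rw [← map_mul, mul_one]
    have h2 : θ 1 * θ b = θ b := by rw [← map_mul, one_mul]
    have h3 : θ 1 * θ 1 = θ 1 := by rw [← map_mul, one_mul]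
    rw [map_mul]
    simp only [mul_add, add_mul, mul_sub, sub_mul, h1, h2, h3, one_mul, mul_one]
    abel

/-- The group homomorphism `u ↦ θ u + (1 - θ 1)` on units. -/
def cornerUnits (θ : S →ₙ+* R) : Sˣ →* Rˣ := Units.map (cornerHom θ)

theorem coe_cornerUnits (θ : S →ₙ+* R) (u : Sˣ) :
    (cornerUnits θ u : R) = θ u + (1 - θ 1) := rfl

/-- The unit `1 + N` for `N` of square zero. -/
def unipotent (N : R) (hN : N * N = 0) : Rˣ where
  val := 1 + N
  inv := 1 - N
  val_inv := by simp [mul_sub, add_mul, hN]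
  inv_val := by simp [mul_add, sub_mul, hN]

/-- The unit `(1 + v) (1 - v') (1 + v)`. -/
def exchangeUnit (v v' : R) (hv : v * v = 0) (hv' : v' * v' = 0) : Rˣ :=
  unipotent v hv * unipotent (-v') (by simpa using hv') * unipotent v hv

/-- `v` and `v'` implement an equivalence of the idempotent `e = v' v` with the idempotent `v v'`,
which is orthogonal to `e`. -/
structure OrthogonalEquiv (e v v' : R) : Prop where
  inv_mul : v' * v = e
  mul_src : v * e = v
  src_mul : e * v' = v'
  src_orth : e * v = 0
  orth_src : v' * e = 0

namespace OrthogonalEquiv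

variable {e v v' : R}

theorem sq_zero (h : OrthogonalEquiv e v v') : v * v = 0 := by
  nth_rw 1 [← h.mul_src]
  rw [mul_assoc, h.src_orth, mul_zero]

theorem sq_zero' (h : OrthogonalEquiv e v v') : v' * v' = 0 := by
  nth_rw 2 [← h.src_mul]
  rw [← mul_assoc, h.orth_src, zero_mul]

/-- With f = v v', the exchange unit is 1 - e - f + v - v', a signed swap of the corners e and f. It
is a product of unipotents, hence connected to 1 in a topological algebra. -/
theorem exchange_mul (h : OrthogonalEquiv e v v') {x : R} (h1 : e * x = x) (h2 : x * e = x) :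
    exchangeUnit v v' h.sq_zero h.sq_zero' * (x + (1 - e)) =
      (v * x * v' + (1 - v * v')) * exchangeUnit v v' h.sq_zero h.sq_zero' := by
  have hfv : v * v' * v = v := by rw [mul_assoc, h.inv_mul, h.mul_src]
  have hw : (exchangeUnit v v' h.sq_zero h.sq_zero' : R) = 1 - e - v * v' + v - v' := by
    simp only [exchangeUnit, unipotent, Units.val_mul, mul_add, add_mul, mul_neg, neg_mul,
      one_mul, mul_one, hfv, h.inv_mul, h.sq_zero, add_zero]
    abel
  have o2 : v' * x = 0 := by rw [← h1, ← mul_assoc, h.orth_src, zero_mul]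
  have m0 : e * e = e := by
    nth_rw 1 [← h.inv_mul]
    rw [mul_assoc, h.mul_src, h.inv_mul]
  have m1 : v * x * v' * e = 0 := by rw [mul_assoc, h.orth_src, mul_zero]
  have m2 : v * x * v' * (v * v') = v * x * v' := by
    rw [mul_assoc (v * x), ← mul_assoc v', h.inv_mul, h.src_mul]
  have m3 : v * x * v' * v = v * x := by rw [mul_assoc (v * x), h.inv_mul, mul_assoc, h2]
  have m4 : v * x * v' * v' = 0 := by rw [mul_assoc, h.sq_zero', mul_zero]
  have m5 : v * v' * (v * v') = v * v' := by rw [← mul_assoc, hfv]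
  have m6 : v * v' * v' = 0 := by rw [mul_assoc, h.sq_zero', mul_zero]
  have m7 : v * v' * e = 0 := by rw [mul_assoc, h.orth_src, mul_zero]
  have m8 : v * v' * x = 0 := by rw [mul_assoc, o2, mul_zero]
  rw [hw]
  simp only [mul_add, add_mul, mul_sub, sub_mul, one_mul, mul_one, m0, m1, m2, m3, m4, m5, m6, m7,
    m8, h1, h.mul_src, h.orth_src, o2, hfv]
  abel

theorem conj_eq (h : OrthogonalEquiv e v v') {x : R} (h1 : e * x = x) (h2 : x * e = x) {u w : Rˣ}
    (hu : (u : R) = x + (1 - e)) (hw : (w : R) = v * x * v' + (1 - v * v')) :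
    w = exchangeUnit v v' h.sq_zero h.sq_zero' * u * (exchangeUnit v v' h.sq_zero h.sq_zero')⁻¹ := by
  rw [eq_mul_inv_iff_mul_eq]
  ext
  rw [Units.val_mul, Units.val_mul, hu, hw, h.exchange_mul h1 h2]

theorem abelianization_eq (h : OrthogonalEquiv e v v') {x : R} (h1 : e * x = x) (h2 : x * e = x)
    {u w : Rˣ} (hu : (u : R) = x + (1 - e)) (hw : (w : R) = v * x * v' + (1 - v * v')) :
    Abelianization.of w = Abelianization.of u := by
  rw [h.conj_eq h1 h2 hu hw, map_mul, map_mul, map_inv, mul_inv_cancel_comm]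

theorem cornerUnits_conj_eq {θ θ' : S →ₙ+* R} (h : OrthogonalEquiv (θ 1) v v')
    (hθ : ∀ a, θ' a = v * θ a * v') (u : Sˣ) :
    cornerUnits θ' u = exchangeUnit v v' h.sq_zero h.sq_zero' * cornerUnits θ u *
      (exchangeUnit v v' h.sq_zero h.sq_zero')⁻¹ :=
  h.conj_eq (x := θ u) (by rw [← map_mul, one_mul]) (by rw [← map_mul, mul_one])
    (coe_cornerUnits θ u) (by rw [coe_cornerUnits, hθ, hθ, h.mul_src])

theorem abelianization_cornerUnits_eq {θ θ' : S →ₙ+* R} (h : OrthogonalEquiv (θ 1) v v')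
    (hθ : ∀ a, θ' a = v * θ a * v') (u : Sˣ) :
    Abelianization.of (cornerUnits θ' u) = Abelianization.of (cornerUnits θ u) := by
  rw [h.cornerUnits_conj_eq hθ u, map_mul, map_mul, map_inv, mul_inv_cancel_comm]

end OrthogonalEquiv

/-- Conjugation by 1 + e doubles N, so 1 + N is conjugate to its own square and its class is
trivial. -/
theorem abelianization_unipotent [Algebra ℂ R] {N e : R} (h1 : e * N = N) (h2 : N * e = 0)
    (he : e * e = e) (hN : N * N = 0) : Abelianization.of (unipotent N hN) = 1 := by
  let d : Rˣ :=
    { val := 1 + e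
      inv := 1 - (1 / 2 : ℂ) • e
      val_inv := by
        simp only [mul_sub, add_mul, mul_one, one_mul, mul_smul_comm, he]
        module
      inv_val := by
        simp only [sub_mul, mul_add, mul_one, one_mul, smul_mul_assoc, he]
        module }
  have hd : d * unipotent N hN = unipotent N hN * unipotent N hN * d := by
    ext
    simp only [d, unipotent, Units.val_mul, mul_add, add_mul, mul_one, one_mul, h1, h2, hN,
      zero_mul]
    abel
  have := congrArg Abelianization.of hd
  rw [map_mul, map_mul, map_mul, mul_comm, mul_right_cancel_iff] at this
  exact left_eq_mul.1 this

theorem abelianization_unipotent' [Algebra ℂ R] {N e : R} (h1 : N * e = N) (h2 : e * N = 0)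
    (he : e * e = e) (hN : N * N = 0) : Abelianization.of (unipotent N hN) = 1 := by
  refine abelianization_unipotent (e := 1 - e) ?_ ?_ ?_ hN
  · rw [sub_mul, h2, one_mul, sub_zero]
  · rw [mul_sub, h1, mul_one, sub_self]
  · simp [mul_sub, sub_mul, he]

section Topology

variable [TopologicalSpace R] [TopologicalSpace S]

theorem continuous_cornerUnits [IsTopologicalRing R] {θ : S →ₙ+* R} (hθ : Continuous θ) :
    Continuous (cornerUnits θ) :=
  Continuous.units_map _ (hθ.add continuous_const)

variable [IsTopologicalRing R] [Module ℝ R] [ContinuousSMul ℝ R] [IsScalarTower ℝ R R]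
  [SMulCommClass ℝ R R]

theorem unipotent_mem_connectedComponentOfOne (N : R) (hN : N * N = 0) :
    unipotent N hN ∈ Subgroup.connectedComponentOfOne Rˣ := by
  have hN' : ∀ t : ℝ, (t • N) * (t • N) = 0 := fun t => by
    rw [smul_mul_assoc, mul_smul_comm, hN, smul_zero, smul_zero]
  let f : ℝ → Rˣ := fun t => unipotent (t • N) (hN' t)
  have hf : Continuous f := by
    refine Units.continuous_iff.2 ⟨?_, ?_⟩
    · exact (by fun_prop : Continuous fun t : ℝ => 1 + t • N)
    · exact (by fun_prop : Continuous fun t : ℝ => 1 - t • N)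
  have h0 : f 0 = 1 := by ext; simp [f, unipotent]
  have h1 : f 1 = unipotent N hN := by ext; simp [f, unipotent]
  have := hf.image_connectedComponent_subset 0
  rw [h0, PreconnectedSpace.connectedComponent_eq_univ] at this
  rw [← h1]
  exact this ⟨1, trivial, rfl⟩

theorem exchangeUnit_mem_connectedComponentOfOne (v v' : R) (hv : v * v = 0) (hv' : v' * v' = 0) :
    exchangeUnit v v' hv hv' ∈ Subgroup.connectedComponentOfOne Rˣ :=
  mul_mem (mul_mem (unipotent_mem_connectedComponentOfOne _ _)
    (unipotent_mem_connectedComponentOfOne _ _)) (unipotent_mem_connectedComponentOfOne _ _)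

end Topology

end Corner

/-! ### Endomorphisms of the invertible group given by isometries -/

section Isometries

variable {A : Type*} [CStarAlgebra A]

/-- The corner embedding `a ↦ s a s*` attached to an isometry `s`. -/
def isometryCorner (s : A) (hs : star s * s = 1) : A →ₙ+* A where
  toFun a := s * a * star s
  map_zero' := by simp
  map_add' a b := by simp only [mul_add, add_mul]
  map_mul' a b := by
    rw [mul_assoc (s * a), ← mul_assoc (star s), ← mul_assoc (star s), hs, one_mul]
    simp only [mul_assoc]

theorem isometryCorner_apply (s : A) (hs : star s * s = 1) (a : A) :
    isometryCorner s hs a = s * a * star s := rfl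

theorem star_mul_isometry_mul {s : A} (hs : star s * s = 1) (x y : A) :
    star (s * x) * (s * y) = star x * y := by
  rw [star_mul, mul_assoc, ← mul_assoc (star s), hs, one_mul]

theorem isometry_mul {s t : A} (hs : star s * s = 1) (ht : star t * t = 1) :
    star (s * t) * (s * t) = 1 := by
  rw [star_mul_isometry_mul hs, ht]

/-- The endomorphism `u ↦ s u s* + 1 - s s*` of the invertible group attached to an isometry. -/
def isometryUnits (s : A) (hs : star s * s = 1) : Aˣ →* Aˣ := cornerUnits (isometryCorner s hs)

theorem coe_isometryUnits (s : A) (hs : star s * s = 1) (u : Aˣ) :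
    (isometryUnits s hs u : A) = s * u * star s + (1 - s * star s) := by
  rw [isometryUnits, coe_cornerUnits, isometryCorner_apply, isometryCorner_apply, mul_one]

theorem isometryUnits_isometryUnits {s t : A} (hs : star s * s = 1) (ht : star t * t = 1) (u : Aˣ) :
    isometryUnits s hs (isometryUnits t ht u) = isometryUnits (s * t) (isometry_mul hs ht) u := by
  ext
  simp only [coe_isometryUnits, star_mul, mul_add, add_mul, mul_sub, sub_mul, mul_one, mul_assoc]
  abel

theorem abelianization_isometryUnits_eq {s t : A} (hs : star s * s = 1) (ht : star t * t = 1)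
    (hst : star s * t = 0) (u : Aˣ) :
    Abelianization.of (isometryUnits t ht u) = Abelianization.of (isometryUnits s hs u) := by
  have hts : star t * s = 0 := by simpa using congrArg star hst
  have h : OrthogonalEquiv (isometryCorner s hs 1) (t * star s) (s * star t) := by
    constructor <;> simp only [isometryCorner_apply, mul_one]
    · rw [mul_assoc, ← mul_assoc (star t), ht, one_mul]
    · rw [mul_assoc, ← mul_assoc (star s), hs, one_mul]
    · rw [mul_assoc, ← mul_assoc (star s), hs, one_mul]
    · rw [mul_assoc, ← mul_assoc (star s), hst, zero_mul, mul_zero]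
    · rw [mul_assoc, ← mul_assoc (star t), hts, zero_mul, mul_zero]
  refine h.abelianization_cornerUnits_eq (fun a => ?_) u
  simp only [isometryCorner_apply]
  calc t * a * star t = t * (star s * s) * a * (star s * s) * star t := by
        rw [hs, mul_one, mul_one]
    _ = _ := by simp only [mul_assoc]

/-- If `u` acts as the identity outside the projection `e`, and `e` is orthogonal to the range of
the isometry `s`, then `u` and `s u s* + 1 - s s*` agree modulo commutators. -/
theorem abelianization_isometryUnits_eq_self {s e : A} (hs : star s * s = 1) (he : e * e = e)
    (hes : e * s = 0) (hse : star s * e = 0) {u : Aˣ} (h1 : (u : A) * (1 - e) = 1 - e)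
    (h2 : (1 - e) * (u : A) = 1 - e) :
    Abelianization.of (isometryUnits s hs u) = Abelianization.of u := by
  have hc : e * (u : A) = u * e := by
    rw [mul_sub, mul_one] at h1
    rw [sub_mul, one_mul] at h2
    rw [← sub_right_inj, h1, h2]
  -- The partial isometry s e moves the corner e, where u lives, to an orthogonal one. Since u is 1
  -- off e, the transported element is exactly φ_s(u).
  have h : OrthogonalEquiv e (s * e) (e * star s) := by
    constructor
    · rw [mul_assoc, ← mul_assoc (star s), hs, one_mul, he]
    · rw [mul_assoc, he]
    · rw [← mul_assoc, he]
    · rw [← mul_assoc, hes, zero_mul]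
    · rw [mul_assoc, hse, mul_zero]
  have hu : (u : A) = e * u * e + (1 - e) := by
    nth_rw 1 [← h1]
    rw [hc, mul_assoc, he, mul_sub, mul_one]
    abel
  refine h.abelianization_eq (x := e * u * e) ?_ ?_ hu ?_
  · rw [← mul_assoc, ← mul_assoc, he]
  · rw [mul_assoc, he]
  · rw [coe_isometryUnits]
    nth_rw 1 [hu]
    have : s * e * (e * u * e) * (e * star s) = s * (e * u * e) * star s := by
      simp only [mul_assoc]
      rw [← mul_assoc e e, he, ← mul_assoc e e (star s), he]
    rw [this, mul_assoc s e, ← mul_assoc e e, he]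
    simp only [mul_add, add_mul, mul_sub, sub_mul, mul_one]
    simp only [mul_assoc]
    abel

end Isometries

/-! ### Exponentials are products of commutators after compression -/

section Exponential

variable {A : Type*} [CStarAlgebra A]

/-- The exponential as an invertible element. -/
noncomputable def expUnit (a : A) : Aˣ :=
  letI := NormedAlgebra.restrictScalars ℚ ℂ A
  (NormedSpace.isUnit_exp a).unit

theorem coe_expUnit (a : A) : (expUnit a : A) = NormedSpace.exp a := rfl

theorem expUnit_add {a b : A} (h : Commute a b) : expUnit (a + b) = expUnit a * expUnit b := by
  let _ := NormedAlgebra.restrictScalars ℚ ℂ A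
  ext
  simp only [Units.val_mul, coe_expUnit, NormedSpace.exp_add_of_commute h]

theorem cornerUnits_expUnit (θ : A →ₙ+* A) (hθ : Continuous θ)
    (hc : ∀ (c : ℂ) a, θ (c • a) = c • θ a) (a : A) :
    cornerUnits θ (expUnit a) = expUnit (θ a) := by
  -- θ is not unital, so the two exponential series differ only in the constant term, by the summand
  -- 1 - θ 1 of `cornerUnits`.
  have hpow : ∀ n : ℕ, θ a ^ n = θ (a ^ n) + if n = 0 then 1 - θ 1 else 0 := by
    intro n
    induction n with
    | zero => simp
    | succ n ih =>
      rw [pow_succ, ih, pow_succ, map_mul, add_mul]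
      split_ifs with h <;> simp_all [sub_mul, ← map_mul]
  ext
  rw [coe_cornerUnits, coe_expUnit, coe_expUnit]
  have h1 := NormedSpace.exp_series_hasSum_exp' (𝕂 := ℂ) (θ a)
  have h2 := (NormedSpace.exp_series_hasSum_exp' (𝕂 := ℂ) a).map θ hθ
  have h3 := h2.add (hasSum_ite_eq (0 : ℕ) (1 - θ 1))
  refine h3.unique ?_
  convert h1 using 2 with n
  rw [hpow, smul_add, Function.comp_apply, hc]
  by_cases h : n = 0 <;> simp [h]

theorem isometryUnits_expUnit (s : A) (hs : star s * s = 1) (a : A) :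
    isometryUnits s hs (expUnit a) = expUnit (s * a * star s) :=
  cornerUnits_expUnit _ (by change Continuous fun a => s * a * star s; fun_prop)
    (fun c a => by simp [isometryCorner_apply]) a

/-- The map b ↦ t₁ b t₁* + t₂ b t₂* is a *-homomorphism, hence norm-decreasing; the factor 1/2 makes
the right side a contraction, and b is its fixed point. -/
theorem exists_eq_add_half_conj {t₁ t₂ : A} (h1 : star t₁ * t₁ = 1) (h2 : star t₂ * t₂ = 1)
    (h12 : star t₁ * t₂ = 0) (a : A) :
    ∃ b : A, b = a + (t₁ * ((1 / 2 : ℂ) • b) * star t₁ + t₂ * ((1 / 2 : ℂ) • b) * star t₂) := by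
  have h21 : star t₂ * t₁ = 0 := by simpa using congrArg star h12
  let ψ : A →⋆ₙₐ[ℂ] A :=
    { toFun := fun b => t₁ * b * star t₁ + t₂ * b * star t₂
      map_smul' := fun c b => by simp
      map_zero' := by simp
      map_add' := fun b c => by simp only [mul_add, add_mul]; abel
      map_mul' := fun b c => by
        have k1 : ∀ x, star t₁ * (t₁ * x) = x := fun x => by rw [← mul_assoc, h1, one_mul]
        have k2 : ∀ x, star t₂ * (t₂ * x) = x := fun x => by rw [← mul_assoc, h2, one_mul]
        have k3 : ∀ x, star t₁ * (t₂ * x) = 0 := fun x => by rw [← mul_assoc, h12, zero_mul]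
        have k4 : ∀ x, star t₂ * (t₁ * x) = 0 := fun x => by rw [← mul_assoc, h21, zero_mul]
        simp only [mul_add, add_mul, mul_assoc, k1, k2, k3, k4, mul_zero, add_zero, zero_add]
      map_star' := fun b => by simp [mul_assoc] }
  have hf : ContractingWith (1 / 2) fun b => a + (1 / 2 : ℂ) • ψ b := by
    refine ⟨by norm_num, LipschitzWith.of_dist_le_mul fun x y => ?_⟩
    rw [dist_add_left, dist_eq_norm, dist_eq_norm, ← smul_sub, norm_smul]
    have := NonUnitalStarAlgHom.norm_apply_le ψ (x - y)
    rw [map_sub] at this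
    norm_num
    exact this
  refine ⟨ContractingWith.fixedPoint _ hf, ?_⟩
  nth_rw 1 [← hf.fixedPoint_isFixedPt]
  change _ = a + ψ _
  rw [map_smul]

/-- A swindle: exp b is the compressed exp a times two orthogonal copies of exp (b/2). Modulo
commutators these two copies amount to one copy of exp b, which cancels. -/
theorem abelianization_isometryUnits_expUnit {s₁ s₂ : A} (h1 : star s₁ * s₁ = 1)
    (h2 : star s₂ * s₂ = 1) (h12 : star s₁ * s₂ = 0) (a : A) :
    Abelianization.of (isometryUnits s₁ h1 (expUnit a)) = 1 := by
  have ht1 := isometry_mul h2 h1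
  have ht2 := isometry_mul h2 h2
  have ht : star (s₂ * s₁) * (s₂ * s₂) = 0 := by rw [star_mul_isometry_mul h2, h12]
  obtain ⟨b, hb⟩ := exists_eq_add_half_conj ht1 ht2 ht (s₁ * a * star s₁)
  have hst : ∀ x, star s₁ * (s₂ * x) = 0 := fun x => by rw [← mul_assoc, h12, zero_mul]
  have h21 : star s₂ * s₁ = 0 := by simpa using congrArg star h12
  have hts : ∀ x, star s₂ * (s₁ * x) = 0 := fun x => by rw [← mul_assoc, h21, zero_mul]
  have hss : ∀ x, star s₂ * (s₂ * x) = x := fun x => by rw [← mul_assoc, h2, one_mul]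
  set c := (1 / 2 : ℂ) • b with hc
  have hcb : expUnit b = expUnit c * expUnit c := by
    rw [← expUnit_add (Commute.refl c), hc, ← add_smul]
    norm_num
  have hY : expUnit b = isometryUnits s₁ h1 (expUnit a) *
      (isometryUnits _ ht1 (expUnit c) * isometryUnits _ ht2 (expUnit c)) := by
    nth_rw 1 [hb]
    rw [isometryUnits_expUnit, isometryUnits_expUnit, isometryUnits_expUnit, expUnit_add,
      expUnit_add]
    · simp only [Commute, SemiconjBy, star_mul, mul_assoc, hss, hst, hts, mul_zero]
    · simp only [Commute, SemiconjBy, star_mul, mul_assoc, mul_add, add_mul, hst, hts, mul_zero,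
        add_zero]
  have hd : Abelianization.of (isometryUnits _ (isometry_mul h1 ht1) (expUnit c)) *
      Abelianization.of (isometryUnits _ (isometry_mul h1 ht1) (expUnit c)) =
      Abelianization.of (isometryUnits _ (isometry_mul h1 ht1) (expUnit b)) := by
    rw [hcb, map_mul, map_mul]
  -- The bare exp b cannot yet be compared with its compressions. After applying φ_{s₁}, every
  -- isometry involved has range orthogonal to that of s₂, so all the endomorphisms agree with
  -- φ_{s₂} modulo commutators.
  have hY' := congrArg (fun y => Abelianization.of (isometryUnits s₁ h1 y)) hY
  simp only [map_mul] at hY'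
  rw [isometryUnits_isometryUnits h1 h1, isometryUnits_isometryUnits h1 ht1,
    isometryUnits_isometryUnits h1 ht2,
    abelianization_isometryUnits_eq (isometry_mul h1 ht1) (isometry_mul h1 ht2)
      (by rw [star_mul_isometry_mul h1, ht]), hd,
    ← abelianization_isometryUnits_eq (isometry_mul h1 ht1) h2
      (by rw [star_mul, mul_assoc, h12, mul_zero]),
    abelianization_isometryUnits_eq h1 h2 h12, right_eq_mul] at hY'
  rw [← hY', ← abelianization_isometryUnits_eq (isometry_mul h1 h1) h2
      (by rw [star_mul, mul_assoc, h12, mul_zero]), abelianization_isometryUnits_eq h1 h2 h12]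

/-- Inverse function theorem: the derivative of exp at 0 is the identity. -/
theorem eventually_exists_exp_eq : ∀ᶠ y : A in 𝓝 1, ∃ a : A, NormedSpace.exp a = y := by
  have h := (hasStrictFDerivAt_exp_zero (𝕂 := ℂ) (𝔸 := A)).map_nhds_eq_of_equiv
    (f' := ContinuousLinearEquiv.refl ℂ A)
  rw [NormedSpace.exp_zero] at h
  rw [← h]
  exact eventually_map.2 (Eventually.of_forall fun a => ⟨a, rfl⟩)

end Exponential

/-! ### The commutator subgroup is open -/

section Fragmentation

variable {A : Type*} [CStarAlgebra A]

theorem eventually_abelianization_isometryUnits {s₁ s₂ : A} (h1 : star s₁ * s₁ = 1)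
    (h2 : star s₂ * s₂ = 1) (h12 : star s₁ * s₂ = 0) :
    ∀ᶠ y : A in 𝓝 1, ∃ u : Aˣ, (u : A) = y ∧ Abelianization.of (isometryUnits s₁ h1 u) = 1 := by
  filter_upwards [eventually_exists_exp_eq] with y ⟨a, ha⟩
  exact ⟨expUnit a, ha, abelianization_isometryUnits_expUnit h1 h2 h12 a⟩

/-- Block elimination of `x` with respect to the range projection of the isometry `s`, with pivot
`m = s* x s`. -/
theorem abelianization_eq_of_pivot {s : A} (hs : star s * s = 1) {x m d : Aˣ}
    (hm : (m : A) = star s * x * s)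
    (hd : (d : A) = s * star s + (1 - s * star s) * (x - x * (s * ↑m⁻¹ * star s) * x) *
      (1 - s * star s)) :
    Abelianization.of x = Abelianization.of (isometryUnits s hs m) * Abelianization.of d := by
  set e : A := 1 - s * star s with he_def
  have hes : e * s = 0 := by rw [he_def, sub_mul, one_mul, mul_assoc, hs, mul_one, sub_self]
  have hse : star s * e = 0 := by
    rw [he_def, mul_sub, mul_one, ← mul_assoc, hs, one_mul, sub_self]
  have he : e * e = e := by
    nth_rw 2 [he_def]
    rw [mul_sub, mul_one, ← mul_assoc, hes, zero_mul, sub_zero]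
  have kse : ∀ y, star s * (e * y) = 0 := fun y => by rw [← mul_assoc, hse, zero_mul]
  have kes : ∀ y, e * (s * y) = 0 := fun y => by rw [← mul_assoc, hes, zero_mul]
  have kss : ∀ y, star s * (s * y) = y := fun y => by rw [← mul_assoc, hs, one_mul]
  have kee : ∀ y, e * (e * y) = e * y := fun y => by rw [← mul_assoc, he]
  have kmm : ∀ y : A, ↑m * (↑m⁻¹ * y) = y := fun y => by rw [← mul_assoc, m.mul_inv, one_mul]
  have kmm' : ∀ y : A, ↑m⁻¹ * (↑m * y) = y := fun y => by rw [← mul_assoc, m.inv_mul, one_mul]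
  set Y : A := e * x * s * ↑m⁻¹ * star s with hY
  set Z : A := s * ↑m⁻¹ * star s * x * e with hZ
  have hYY : Y * Y = 0 := by simp only [hY, mul_assoc, kse, mul_zero]
  have hZZ : Z * Z = 0 := by simp only [hZ, mul_assoc, kes, mul_zero]
  -- Lower-diagonal-upper factorization, with d carrying the Schur complement of m; the triangular
  -- factors have trivial class.
  have hx : x = unipotent Y hYY * isometryUnits s hs m * d * unipotent Z hZZ := by
    have hb : (isometryUnits s hs m * d : A) = s * m * star s +
        e * (x - x * (s * ↑m⁻¹ * star s) * x) * e := by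
      rw [coe_isometryUnits, hd, ← he_def]
      simp only [add_mul, mul_add, mul_assoc, kss, kse, kes, kee, mul_zero, add_zero, zero_add]
    have hxm : s * m * star s = (1 - e) * x * (1 - e) := by
      rw [hm, he_def]
      simp only [sub_sub_cancel, mul_assoc]
    ext
    rw [Units.val_mul, Units.val_mul, Units.val_mul, mul_assoc (_ : A) _ (d : A), hb]
    have hYm : Y * (s * m * star s) = e * x * (1 - e) := by
      rw [he_def, sub_sub_cancel, ← he_def]
      simp only [hY, mul_assoc, kss, kmm']
    have hmZ : (s * m * star s) * Z = (1 - e) * x * e := by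
      rw [he_def, sub_sub_cancel, ← he_def]
      simp only [hZ, mul_assoc, kss, kmm]
    have hYmZ : e * x * (1 - e) * Z = e * x * (s * ↑m⁻¹ * star s) * x * e := by
      rw [← hYm]
      simp only [hY, hZ, mul_assoc, kss, kmm]
    have hYc : ∀ c, Y * (e * c * e) = 0 := fun c => by simp only [hY, mul_assoc, kse, mul_zero]
    have hcZ : ∀ c, e * c * e * Z = 0 := fun c => by simp only [hZ, mul_assoc, kes, mul_zero]
    simp only [unipotent]
    simp only [add_mul, mul_add, one_mul, mul_one, hYc, hcZ, hYmZ, hmZ, hYm, add_zero]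
    rw [hxm]
    simp only [mul_sub, sub_mul, one_mul, mul_one, mul_assoc]
    abel
  have hYu : Abelianization.of (unipotent Y hYY) = 1 :=
    abelianization_unipotent (e := e) (by simp only [hY, mul_assoc, kee])
      (by simp only [hY, mul_assoc, hse, mul_zero]) he hYY
  have hZu : Abelianization.of (unipotent Z hZZ) = 1 :=
    abelianization_unipotent' (e := e) (by simp only [hZ, mul_assoc, he])
      (by simp only [hZ, mul_assoc, kes]) he hZZ
  nth_rw 1 [hx]
  rw [map_mul, map_mul, map_mul, hYu, hZu, one_mul, mul_one]

/-- For x near 1 the pivot and the Schur complement factor are near 1, hence exponentials. The pivot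
already appears compressed by s₁; the other factor lives in the corner orthogonal to s₁, so it may
be replaced by its compression. -/
theorem eventually_abelianization_eq_one {s₁ s₂ : A} (h1 : star s₁ * s₁ = 1)
    (h2 : star s₂ * s₂ = 1) (h12 : star s₁ * s₂ = 0) :
    ∀ᶠ x : Aˣ in 𝓝 1, Abelianization.of x = 1 := by
  have hgood := eventually_abelianization_isometryUnits h1 h2 h12
  let e : A := 1 - s₁ * star s₁
  have hes : e * s₁ = 0 := by rw [sub_mul, one_mul, mul_assoc, h1, mul_one, sub_self]
  have hse : star s₁ * e = 0 := by
    rw [mul_sub, mul_one, ← mul_assoc, h1, one_mul, sub_self]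
  have he : e * e = e := by
    change e * (1 - s₁ * star s₁) = e
    rw [mul_sub, mul_one, ← mul_assoc, hes, zero_mul, sub_zero]
  let M : Aˣ → A := fun x => star s₁ * x * s₁
  -- `Ring.inverse` is zero at non-units, which is harmless: only continuity at x = 1, where the
  -- pivot is 1, is used.
  let D : Aˣ → A := fun x => s₁ * star s₁ +
    e * (x - x * (s₁ * Ring.inverse (M x) * star s₁) * x) * e
  have hM1 : M 1 = 1 := by simp [M, h1]
  have hM : ContinuousAt M 1 :=
    (by dsimp only [M]; fun_prop : Continuous M).continuousAt
  have hinv : ContinuousAt (fun x => Ring.inverse (M x)) 1 :=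
    ContinuousAt.comp (g := Ring.inverse) (by
      rw [hM1]; exact NormedRing.inverse_continuousAt (1 : Aˣ)) hM
  have hval : ContinuousAt (fun x : Aˣ => (x : A)) 1 := Units.continuous_val.continuousAt
  have hD : ContinuousAt D 1 := by
    dsimp only [D]
    fun_prop
  have hD1 : D 1 = 1 := by
    simp only [D, hM1, Ring.inverse_one, Units.val_one, mul_one, one_mul]
    rw [show 1 - s₁ * star s₁ = e from rfl, he, he]
    simp [e]
  have hM' : Tendsto M (𝓝 1) (𝓝 1) := by simpa only [ContinuousAt, hM1] using hM
  have hD' : Tendsto D (𝓝 1) (𝓝 1) := by simpa only [ContinuousAt, hD1] using hD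
  filter_upwards [hM'.eventually hgood, hD'.eventually hgood] with x ⟨m, hm, hm1⟩ ⟨d, hd, hd1⟩
  have hd' : (d : A) = s₁ * star s₁ + e * (x - x * (s₁ * ↑m⁻¹ * star s₁) * x) * e := by
    rw [hd]
    simp only [D, ← hm, Ring.inverse_unit]
  have h1e : 1 - e = s₁ * star s₁ := sub_sub_cancel _ _
  rw [abelianization_eq_of_pivot h1 hm hd', hm1, one_mul,
    ← abelianization_isometryUnits_eq_self h1 he hes hse (u := d), hd1]
  · rw [hd', h1e]
    simp only [add_mul, mul_assoc, ← mul_assoc e s₁, hes, zero_mul, mul_zero, add_zero]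
    rw [← mul_assoc (star s₁), h1, one_mul]
  · rw [hd', h1e]
    simp only [mul_add, mul_assoc, ← mul_assoc (star s₁) e, hse, zero_mul, mul_zero, add_zero]
    rw [← mul_assoc (star s₁), h1, one_mul]

theorem commutator_isOpen {s₁ s₂ : A} (h1 : star s₁ * s₁ = 1)
    (h2 : star s₂ * s₂ = 1) (h12 : star s₁ * s₂ = 0) : IsOpen (commutator Aˣ : Set Aˣ) := by
  refine Subgroup.isOpen_of_mem_nhds _ (g := 1) ?_
  filter_upwards [eventually_abelianization_eq_one h1 h2 h12] with x hx
  rwa [← Abelianization.ker_of, SetLike.mem_coe, MonoidHom.mem_ker]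

theorem connectedComponentOfOne_le_commutator {s₁ s₂ : A} (h1 : star s₁ * s₁ = 1)
    (h2 : star s₂ * s₂ = 1) (h12 : star s₁ * s₂ = 0) :
    Subgroup.connectedComponentOfOne Aˣ ≤ commutator Aˣ := by
  have ho := commutator_isOpen h1 h2 h12
  have hc : IsClopen (commutator Aˣ : Set Aˣ) := ⟨Subgroup.isClosed_of_isOpen _ ho, ho⟩
  exact hc.connectedComponent_subset (one_mem _)

end Fragmentation

/-! ### Orthogonal isometries under an infinite projection -/

section Simple

variable {A : Type*} [CStarAlgebra A]

/-- The elements `∑ aᵢ q bᵢ` of the algebraic two-sided ideal generated by `q`. -/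
def IsSandwichSum (q z : A) : Prop :=
  ∃ (n : ℕ) (a b : Fin n → A), z = ∑ i, a i * q * b i

namespace IsSandwichSum

variable {q z w : A}

theorem zero : IsSandwichSum q 0 := ⟨0, Fin.elim0, Fin.elim0, by simp⟩

theorem self : IsSandwichSum q q := ⟨1, fun _ => 1, fun _ => 1, by simp⟩

theorem add (hz : IsSandwichSum q z) (hw : IsSandwichSum q w) : IsSandwichSum q (z + w) := by
  obtain ⟨m, a, b, rfl⟩ := hz
  obtain ⟨n, c, d, rfl⟩ := hw
  exact ⟨m + n, Fin.append a c, Fin.append b d, by simp [Fin.sum_univ_add]⟩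

theorem mul_left (x : A) (hz : IsSandwichSum q z) : IsSandwichSum q (x * z) := by
  obtain ⟨m, a, b, rfl⟩ := hz
  exact ⟨m, fun i => x * a i, b, by simp [Finset.mul_sum, mul_assoc]⟩

theorem mul_right (x : A) (hz : IsSandwichSum q z) : IsSandwichSum q (z * x) := by
  obtain ⟨m, a, b, rfl⟩ := hz
  exact ⟨m, a, fun i => b i * x, by simp [Finset.sum_mul, mul_assoc]⟩

theorem neg (hz : IsSandwichSum q z) : IsSandwichSum q (-z) := by
  simpa using hz.mul_left (-1)

end IsSandwichSum

theorem IsSimpleCStarAlgebra.exists_sum_eq_one (hA : IsSimpleCStarAlgebra A) {q : A} (hq : q ≠ 0) :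
    IsSandwichSum q 1 := by
  let C : Set A := closure {z | IsSandwichSum q z}
  let I : TwoSidedIdeal A := TwoSidedIdeal.mk' C
    (subset_closure IsSandwichSum.zero)
    (fun hx hy => map_mem_closure₂ continuous_add hx hy fun _ ha _ hb => ha.add hb)
    (fun hx => map_mem_closure continuous_neg hx fun _ ha => ha.neg)
    (fun {x _} hy => map_mem_closure (continuous_const_mul x) hy fun _ ha => ha.mul_left x)
    (fun {_ y} hx => map_mem_closure (f := (· * y)) (continuous_mul_const y) hx
      fun _ ha => ha.mul_right y)
  have hI : (I : Set A) = C := by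
    ext x
    exact TwoSidedIdeal.mem_mk' ..
  rcases hA.2 I (hI ▸ isClosed_closure) with h | h
  · have hqI : q ∈ (I : Set A) := hI ▸ subset_closure IsSandwichSum.self
    rw [h] at hqI
    exact absurd hqI (by simpa using hq)
  · have h1 : (1 : A) ∈ C := by
      rw [← hI, h]
      trivial
    -- The units form a neighbourhood of 1, so the algebraic ideal, being dense, already contains a
    -- unit.
    obtain ⟨z, ⟨u, hu⟩, hz⟩ := mem_closure_iff_nhds.1 h1 _ (Units.nhds (1 : Aˣ))
    have hz : IsSandwichSum q z := hz
    rw [← hu] at hz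
    simpa using hz.mul_left (↑u⁻¹ : A)

/-- From 1 = y* y'* y' y ≤ ‖y'‖² y* y, the element y* y is invertible; a is its inverse square root.
-/
theorem exists_conj_star_mul_self_eq_one {y y' : A} (h : y' * y = 1) :
    ∃ a : A, star a = a ∧ a * (star y * y) * a = 1 := by
  nontriviality A
  let _ := CStarAlgebra.spectralOrder A
  have _ := CStarAlgebra.spectralOrderedRing A
  have h1 : (1 : A) ≤ algebraMap ℝ A (‖y'‖ ^ 2) * (star y * y) := by
    have := star_left_conjugate_le_conjugate
      (CStarAlgebra.star_mul_le_algebraMap_norm_sq (a := y')) y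
    calc (1 : A) = star y * (star y' * y') * y := by
          rw [mul_assoc, mul_assoc, h, mul_one, ← star_mul, h, star_one]
      _ ≤ _ := this
      _ = _ := by rw [← Algebra.commutes, mul_assoc]
  have hu := CStarAlgebra.isUnit_of_le 1 h1
  have hu' : IsUnit (star y * y) :=
    ((show Commute (algebraMap ℝ A (‖y'‖ ^ 2)) (star y * y) from
      Algebra.commutes _ _).isUnit_mul_iff.1 hu).2
  have hp : IsStrictlyPositive (star y * y) := hu'.isStrictlyPositive (star_mul_self_nonneg y)
  exact ⟨(star y * y) ^ (-(1 / 2) : ℝ), (IsSelfAdjoint.of_nonneg CFC.rpow_nonneg).star_eq,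
    CFC.conjugate_rpow_neg_one_half _ hp⟩

/-- In a simple unital C*-algebra, every infinite projection dominates the ranges of two isometries
with orthogonal ranges. -/
theorem IsSimpleCStarAlgebra.exists_isometries (hA : IsSimpleCStarAlgebra A) {p : A}
    (hp : IsInfiniteProjection p) :
    ∃ s₁ s₂ : A, star s₁ * s₁ = 1 ∧ star s₂ * s₂ = 1 ∧ star s₁ * s₂ = 0 ∧
      p * s₁ = s₁ ∧ p * s₂ = s₂ := by
  obtain ⟨⟨hpp, hps⟩, v, hv, hvp, hne⟩ := hp
  replace hpp : p * p = p := hpp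
  replace hps : star p = p := hps
  have vp : v * p = v := by
    rw [← sub_eq_zero, ← CStarRing.star_mul_self_eq_zero_iff, star_sub, star_mul, hps, sub_mul,
      mul_sub, mul_sub, ← mul_assoc, hv, mul_assoc p, hv, hpp, ← mul_assoc, hv, hpp, sub_self]
  have pv : p * v = v := by
    have := congrArg (· * v) hvp
    simp only [mul_assoc, hv, vp] at this
    exact this
  set q : A := p - v * star v with hq
  have hq0 : q ≠ 0 := sub_ne_zero.2 hne.symm
  -- The defect projection q is wandering for v: the elements vⁱ q are partial isometries with
  -- source q and pairwise orthogonal ranges under p.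
  have hqs : star q = q := by rw [hq, star_sub, star_mul, star_star, hps]
  have pq : p * q = q := by rw [hq, mul_sub, hpp, hvp]
  have qv : q * v = 0 := by rw [hq, sub_mul, pv, mul_assoc, hv, vp, sub_self]
  have qq : q * q = q := by
    nth_rw 2 [hq]
    rw [mul_sub, ← mul_assoc, qv, zero_mul, sub_zero]
    rw [← hqs, ← hps, ← star_mul, pq]
  have pvq : ∀ m : ℕ, p * (v ^ m * q) = v ^ m * q := by
    intro m
    cases m with
    | zero => simpa using pq
    | succ m => rw [pow_succ', mul_assoc, ← mul_assoc p, pv]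
  have hpow : ∀ i k : ℕ, star (v ^ i) * (v ^ (i + k) * q) = v ^ k * q := by
    intro i k
    induction i with
    | zero => simp
    | succ i ih =>
      rw [pow_succ' v i, star_mul, show i + 1 + k = i + k + 1 by ring, pow_succ', mul_assoc v,
        mul_assoc, ← mul_assoc (star v), hv, pvq, ih]
  have worth : ∀ i k : ℕ, star (v ^ i * q) * (v ^ (i + k) * q) = if k = 0 then q else 0 := by
    intro i k
    rw [star_mul, mul_assoc, hpow, hqs]
    cases k with
    | zero => simpa using qq
    | succ k => rw [pow_succ', mul_assoc, ← mul_assoc, qv, zero_mul, if_neg (Nat.succ_ne_zero k)]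
  have worth' : ∀ i j : ℕ, star (v ^ i * q) * (v ^ j * q) = if i = j then q else 0 := by
    intro i j
    rcases le_total i j with h | h
    · obtain ⟨k, rfl⟩ := Nat.exists_eq_add_of_le h
      rw [worth]
      simp
    · obtain ⟨k, rfl⟩ := Nat.exists_eq_add_of_le h
      rw [← star_star (v ^ j * q), ← star_mul, worth]
      split_ifs <;> simp_all
  obtain ⟨n, a, b, hab⟩ := hA.exists_sum_eq_one hq0
  -- Orthogonality of the ranges turns ∑ aᵢ q bᵢ = 1 into a left inverse of y. The shift vⁿ y uses
  -- the exponents n, …, 2n - 1, disjoint from those of y; y and vⁿ y are then normalized by c.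
  set y : A := ∑ i : Fin n, v ^ (i : ℕ) * q * b i with hy
  have hy1 : (∑ i : Fin n, a i * star (v ^ (i : ℕ) * q)) * y = 1 := by
    rw [hy, Finset.sum_mul_sum, hab]
    refine Finset.sum_congr rfl fun i _ => ?_
    have : ∀ j : Fin n, a i * star (v ^ (i : ℕ) * q) * (v ^ (j : ℕ) * q * b j) =
        if i = j then a i * q * b i else 0 := by
      intro j
      rw [mul_assoc, ← mul_assoc (star _), worth']
      by_cases h : i = j
      · simp [h, mul_assoc]
      · simp [h, Fin.val_inj]
    simp only [this, Finset.sum_ite_eq, Finset.mem_univ, if_true]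
  have hy2 : star y * (v ^ n * y) = 0 := by
    rw [hy, star_sum, Finset.mul_sum, Finset.sum_mul_sum]
    refine Finset.sum_eq_zero fun i _ => Finset.sum_eq_zero fun j _ => ?_
    rw [star_mul, mul_assoc, ← mul_assoc (v ^ n), ← mul_assoc (v ^ n), ← pow_add,
      ← mul_assoc (star (v ^ (i : ℕ) * q)), worth', if_neg (by omega), zero_mul, mul_zero]
  have hy3 : star (v ^ n) * (v ^ n * y) = y := by
    rw [hy, Finset.mul_sum, Finset.mul_sum]
    refine Finset.sum_congr rfl fun i _ => ?_
    rw [← mul_assoc (v ^ n), ← mul_assoc (v ^ n), ← pow_add, ← mul_assoc (star _), hpow]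
  have py : p * y = y := by
    rw [hy, Finset.mul_sum]
    refine Finset.sum_congr rfl fun i _ => ?_
    rw [← mul_assoc, pvq]
  have pvy : p * (v ^ n * y) = v ^ n * y := by
    rw [hy, Finset.mul_sum, Finset.mul_sum]
    refine Finset.sum_congr rfl fun i _ => ?_
    rw [← mul_assoc (v ^ n), ← mul_assoc (v ^ n), ← pow_add, ← mul_assoc p, pvq]
  obtain ⟨c, hc, hc1⟩ := exists_conj_star_mul_self_eq_one hy1
  refine ⟨y * c, v ^ n * y * c, ?_, ?_, ?_, ?_, ?_⟩
  · rw [star_mul, hc, mul_assoc, ← mul_assoc (star y), ← mul_assoc, hc1]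
  · rw [star_mul, star_mul, hc, mul_assoc c, mul_assoc (star y), ← mul_assoc (star (v ^ n)), hy3,
      ← mul_assoc (star y), ← mul_assoc, hc1]
  · rw [star_mul, mul_assoc, ← mul_assoc (star y), hy2, zero_mul, mul_zero]
  · rw [← mul_assoc, py]
  · rw [← mul_assoc, pvy]

end Simple

/-! ### Infinite projections almost annihilated by a given element -/

section InfiniteProjection

variable {A : Type*} [CStarAlgebra A]

/-- The two-sided annihilator of a self-adjoint element. -/
def annihilatorSubalgebra (k : A) (hk : star k = k) : NonUnitalStarSubalgebra ℂ A where
  carrier := {x | x * k = 0 ∧ k * x = 0}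
  zero_mem' := by simp
  add_mem' := fun {x y} hx hy => by simp [add_mul, mul_add, hx.1, hx.2, hy.1, hy.2]
  mul_mem' := fun {x y} hx hy =>
    ⟨by rw [mul_assoc, hy.1, mul_zero], by rw [← mul_assoc, hx.2, zero_mul]⟩
  smul_mem' := fun c x hx => by simp [hx.1, hx.2]
  star_mem' := fun {x} hx => by
    constructor
    · rw [← star_star (star x * k), star_mul, star_star, hk, hx.2, star_zero]
    · rw [← star_star (k * star x), star_mul, star_star, hk, hx.1, star_zero]

theorem mem_annihilatorSubalgebra {k : A} {hk : star k = k} {x : A} :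
    x ∈ annihilatorSubalgebra k hk ↔ x * k = 0 ∧ k * x = 0 := Iff.rfl

theorem isHereditary_annihilatorSubalgebra (k : A) (hk : star k = k) :
    IsHereditaryCStarSubalgebra (annihilatorSubalgebra k hk) := by
  let _ := CStarAlgebra.spectralOrder A
  have _ := CStarAlgebra.spectralOrderedRing A
  constructor
  · have h1 : IsClosed {x : A | x * k = 0} := isClosed_eq (by fun_prop) continuous_const
    have h2 : IsClosed {x : A | k * x = 0} := isClosed_eq (by fun_prop) continuous_const
    exact h1.inter h2
  · rintro a b ⟨x, rfl⟩ ⟨z, hz⟩ hb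
    rw [mem_annihilatorSubalgebra] at hb ⊢
    have h0 : star (x * k) * (x * k) + star (z * k) * (z * k) = 0 := by
      have : star (x * k) * (x * k) + star (z * k) * (z * k) = k * b * k := by
        rw [eq_add_of_sub_eq hz]
        simp only [star_mul, hk, mul_add, add_mul, mul_assoc]
        abel
      rw [this, hb.2, zero_mul]
    have hx := ((add_eq_zero_iff_of_nonneg (star_mul_self_nonneg _) (star_mul_self_nonneg _)).1
      h0).1
    rw [CStarRing.star_mul_self_eq_zero_iff] at hx
    have hx' : k * star x = 0 := by simpa [hk] using congrArg star hx
    exact ⟨by rw [mul_assoc, hx, mul_zero], by rw [← mul_assoc, hx', zero_mul]⟩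

/-- The projection is taken in the annihilator of the positive part of w* w - ε², where w* w is at
most ε². This annihilator contains the negative part, which is nonzero since otherwise w* w ≥ ε²
would be invertible. -/
theorem IsPurelyInfinite.exists_norm_mul_le (hA : IsPurelyInfinite A) {w : A}
    (hw : ¬ IsUnit (star w * w)) {ε : ℝ} (hε : 0 < ε) :
    ∃ p : A, IsInfiniteProjection p ∧ ‖w * p‖ ≤ ε := by
  let _ := CStarAlgebra.spectralOrder A
  have _ := CStarAlgebra.spectralOrderedRing A
  set δ : A := algebraMap ℝ A (ε ^ 2) with hδ
  have hδ0 : 0 ≤ δ := algebraMap_nonneg A (by positivity)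
  have hδu : IsUnit δ := (IsUnit.mk0 (ε ^ 2) (by positivity)).map (algebraMap ℝ A)
  have hδs : IsSelfAdjoint δ := .of_nonneg hδ0
  have hh : IsSelfAdjoint (star w * w - δ) := (IsSelfAdjoint.star_mul_self w).sub hδs
  set k := (star w * w - δ)⁺ with hk
  set k' := (star w * w - δ)⁻ with hk'
  have hkk : k - k' = star w * w - δ := CFC.posPart_sub_negPart _ hh
  have hk0 : 0 ≤ k := CFC.posPart_nonneg _
  have hk'0 : 0 ≤ k' := CFC.negPart_nonneg _
  have hks : star k = k := (IsSelfAdjoint.of_nonneg hk0).star_eq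
  have hmem : k' ∈ annihilatorSubalgebra k hks :=
    ⟨CFC.negPart_mul_posPart _, CFC.posPart_mul_negPart _⟩
  have hne : annihilatorSubalgebra k hks ≠ ⊥ := by
    intro h
    rw [h] at hmem
    have h0 : k' = 0 := NonUnitalStarAlgebra.mem_bot.1 hmem
    rw [h0, sub_zero] at hkk
    rw [hkk, sub_nonneg] at hk0
    exact hw (CStarAlgebra.isUnit_of_le δ hk0 (hδu.isStrictlyPositive hδ0))
  obtain ⟨p, hp, hinf⟩ := hA _ (isHereditary_annihilatorSubalgebra k hks) hne
  refine ⟨p, hinf, ?_⟩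
  have hps : star p = p := hinf.1.isSelfAdjoint
  have hpp : p * p = p := hinf.1.isIdempotentElem
  have hpk : p * k = 0 := hp.1
  have e1 : star (w * p) * (w * p) = δ * p - p * k' * p := by
    have : star w * w = δ + k - k' := by rw [add_sub_assoc, hkk]; abel
    calc star (w * p) * (w * p) = p * (star w * w) * p := by
          rw [star_mul, hps]; simp only [mul_assoc]
      _ = p * δ * p + p * k * p - p * k' * p := by rw [this]; noncomm_ring
      _ = _ := by rw [hpk, zero_mul, add_zero, ← Algebra.commutes, mul_assoc, hpp]
  have e2 : 0 ≤ p * k' * p := by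
    have := star_left_conjugate_nonneg hk'0 p
    rwa [hps] at this
  have e3 : ‖star (w * p) * (w * p)‖ ≤ ‖δ * p‖ :=
    CStarAlgebra.norm_le_norm_of_nonneg_of_le (star_mul_self_nonneg _)
      (by rw [e1]; exact sub_le_self _ e2)
  have e4 : ‖δ * p‖ ≤ ε ^ 2 := by
    rw [hδ, ← Algebra.smul_def, norm_smul, Real.norm_of_nonneg (by positivity)]
    exact mul_le_of_le_one_right (by positivity) hinf.1.norm_le
  rw [CStarRing.norm_star_mul_self, ← pow_two] at e3
  exact le_of_sq_le_sq (e3.trans e4) hε.le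

end InfiniteProjection

/-! ### Every invertible agrees with one of its compressions modulo commutators -/

section Representatives

variable {A : Type*} [CStarAlgebra A]

theorem eventually_exists_abelianization_eq {s₁ s₂ : A} (h1 : star s₁ * s₁ = 1)
    (h2 : star s₂ * s₂ = 1) (h12 : star s₁ * s₂ = 0) (u : Aˣ) :
    ∀ᶠ y in 𝓝 (u : A), ∃ x : Aˣ, (x : A) = y ∧ Abelianization.of x = Abelianization.of u := by
  rw [← Units.isOpenEmbedding_val.map_nhds_eq u, eventually_map]
  have ht : Tendsto (fun x : Aˣ => x * u⁻¹) (𝓝 u) (𝓝 1) := by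
    have : Continuous fun x : Aˣ => x * u⁻¹ := by fun_prop
    simpa using this.tendsto u
  filter_upwards [ht.eventually (eventually_abelianization_eq_one h1 h2 h12)] with x hx
  refine ⟨x, rfl, ?_⟩
  rwa [map_mul, map_inv, mul_inv_eq_one] at hx

theorem expUnit_mem_connectedComponentOfOne (a : A) :
    expUnit a ∈ Subgroup.connectedComponentOfOne Aˣ := by
  let _ := NormedAlgebra.restrictScalars ℚ ℂ A
  have hf : Continuous fun t : ℝ => expUnit (t • a) := by
    rw [Units.isOpenEmbedding_val.isEmbedding.continuous_iff]
    exact NormedSpace.exp_continuous.comp (by fun_prop : Continuous fun t : ℝ => t • a)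
  have := hf.image_connectedComponent_subset 0
  rw [PreconnectedSpace.connectedComponent_eq_univ] at this
  have h0 : expUnit (0 : A) = 1 := by ext; simp [coe_expUnit, NormedSpace.exp_zero]
  rw [zero_smul, h0] at this
  exact this ⟨1, trivial, by simp⟩

theorem abelianization_map_eq {G H : Type*} [Group G] [Group H] (f : G →* H) {x y : G}
    (h : Abelianization.of x = Abelianization.of y) :
    Abelianization.of (f x) = Abelianization.of (f y) := by
  rw [← Abelianization.map_of, ← Abelianization.map_of, h]

theorem exists_isometryUnits_eq_of_mul_proj {p s : A} (hp : IsStarProjection p)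
    (hs : star s * s = 1) (hps : p * s = s) {u : Aˣ} (hu : (u : A) * p = p) :
    Abelianization.of (isometryUnits s hs u) = Abelianization.of u := by
  have hpp : p * p = p := hp.isIdempotentElem
  have hp' : star p = p := hp.isSelfAdjoint
  have hsp : star s * p = star s := by rw [← hp', ← star_mul, hps]
  -- Since u p = p, u is block upper triangular with corner 1 at p. Right multiplication by 1 + y
  -- clears the off-diagonal block, leaving an element supported on 1 - p, orthogonal to the range
  -- of s.
  set y : A := -(p * u * (1 - p)) with hy
  have h1 : y * p = 0 := by rw [hy, neg_mul, mul_assoc, sub_mul, one_mul, hpp, sub_self, mul_zero,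
    neg_zero]
  have h2 : p * y = y := by rw [hy, mul_neg, ← mul_assoc, ← mul_assoc, hpp]
  have hyy : y * y = 0 := by
    nth_rw 2 [← h2]
    rw [← mul_assoc, h1, zero_mul]
  have hab : Abelianization.of (u * unipotent y hyy) = Abelianization.of u := by
    rw [map_mul, abelianization_unipotent h2 h1 hpp hyy, mul_one]
  rw [← hab, ← abelianization_map_eq (isometryUnits s hs) hab]
  have hr : ((u * unipotent y hyy : Aˣ) : A) * p = p := by
    rw [Units.val_mul, mul_assoc]
    simp only [unipotent]
    rw [add_mul, h1, add_zero, one_mul, hu]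
  have hl : p * ((u * unipotent y hyy : Aˣ) : A) = p := by
    rw [Units.val_mul]
    simp only [unipotent]
    have : (u : A) * y = y := by
      rw [← h2, ← mul_assoc, hu]
    rw [mul_add, mul_one, this, mul_add, h2, hy, mul_sub, mul_one, mul_assoc p (u : A) p, hu, hpp]
    abel
  refine abelianization_isometryUnits_eq_self (e := 1 - p) hs hp.one_sub.isIdempotentElem ?_ ?_ ?_ ?_
  · rw [sub_mul, hps, one_mul, sub_self]
  · rw [mul_sub, hsp, mul_one, sub_self]
  · rw [sub_sub_cancel, hr]
  · rw [sub_sub_cancel, hl]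

/-- With (u - 1) p small, x = u - (u - 1) p is close enough to u to have the same class, and x p =
p. The isometries are then taken under p. -/
theorem exists_isometries_fixing_of_not_isUnit (hA : IsSimpleCStarAlgebra A)
    (hA' : IsPurelyInfinite A) {u : Aˣ}
    (hu : ¬ IsUnit (star ((u : A) - 1) * ((u : A) - 1))) :
    ∃ s₁ s₂ : A, ∃ h1 : star s₁ * s₁ = 1, star s₂ * s₂ = 1 ∧ star s₁ * s₂ = 0 ∧
      Abelianization.of (isometryUnits s₁ h1 u) = Abelianization.of u := by
  have hex : ∀ ε : ℝ, 0 < ε → ∃ p : A, IsInfiniteProjection p ∧ ‖((u : A) - 1) * p‖ ≤ ε :=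
    fun ε hε => hA'.exists_norm_mul_le hu hε
  -- The auxiliary p₀ only supplies isometries showing that classes are locally constant; this fixes
  -- ε before p is chosen.
  obtain ⟨p₀, hp₀, -⟩ := hex 1 one_pos
  obtain ⟨t₁, t₂, ht1, ht2, ht12, -, -⟩ := hA.exists_isometries hp₀
  obtain ⟨ε, hε, hball⟩ := Metric.eventually_nhds_iff.1
    (eventually_exists_abelianization_eq ht1 ht2 ht12 u)
  obtain ⟨p, hp, hup⟩ := hex (ε / 2) (by positivity)
  obtain ⟨x, hx, hxu⟩ := hball (y := u - (u - 1) * p) (by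
    rw [dist_eq_norm, sub_sub_cancel_left, norm_neg]
    linarith)
  obtain ⟨s₁, s₂, h1, h2, h12, hps, -⟩ := hA.exists_isometries hp
  have hpp : p * p = p := hp.1.isIdempotentElem
  have hxp : (x : A) * p = p := by
    rw [hx, sub_mul, mul_assoc, hpp, sub_mul, one_mul, sub_sub_cancel]
  refine ⟨s₁, s₂, h1, h2, h12, ?_⟩
  rw [← hxu, ← abelianization_map_eq (isometryUnits s₁ h1) hxu]
  exact exists_isometryUnits_eq_of_mul_proj hp.1 h1 hps hxp

theorem star_isometryUnits (s : A) (hs : star s * s = 1) (u : Aˣ) :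
    star (isometryUnits s hs u) = isometryUnits s hs (star u) := by
  ext
  simp only [Units.coe_star, coe_isometryUnits, star_add, star_sub, star_mul, star_star, star_one,
    mul_assoc]

theorem abelianization_star_eq {u w : Aˣ}
    (h : Abelianization.of (star u) = Abelianization.of (star w)) :
    Abelianization.of u = Abelianization.of w := by
  -- The adjoint reverses products; composing with inversion makes it an endomorphism.
  let σ : Aˣ →* Aˣ := MonoidHom.mk' (fun x => (star x)⁻¹) fun x y => by simp
  simpa [σ] using abelianization_map_eq σ h

/-- Modulo commutators, every invertible element `u` of a purely infinite simple C*-algebra is equal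
to `s u s* + 1 - s s*` for a suitable isometry `s`, depending on `u`. -/
theorem exists_isometries_fixing (hA : IsSimpleCStarAlgebra A) (hA' : IsPurelyInfinite A) (u : Aˣ) :
    ∃ s₁ s₂ : A, ∃ h1 : star s₁ * s₁ = 1, star s₂ * s₂ = 1 ∧ star s₁ * s₂ = 0 ∧
      Abelianization.of (isometryUnits s₁ h1 u) = Abelianization.of u := by
  have := hA.1
  obtain ⟨c, hc⟩ := spectrum.nonempty (u : A)
  have hc0 : c ≠ 0 := by
    rintro rfl
    exact spectrum.zero_notMem ℂ u.isUnit hc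
  -- Rescaling by c⁻¹ moves the spectral value c of u to 1. This scalar is an exponential, so it
  -- does not change the class.
  let z : Aˣ := expUnit (algebraMap ℂ A (Complex.log c⁻¹))
  have hz : (z : A) = algebraMap ℂ A c⁻¹ := by
    rw [coe_expUnit, ← NormedSpace.algebraMap_exp_comm, ← Complex.exp_eq_exp_ℂ,
      Complex.exp_log (inv_ne_zero hc0)]
  have hzu : ∀ s₁ s₂ : A, ∀ h1 : star s₁ * s₁ = 1, star s₂ * s₂ = 1 → star s₁ * s₂ = 0 →
      Abelianization.of (isometryUnits s₁ h1 (z * u)) = Abelianization.of (z * u) →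
      Abelianization.of (isometryUnits s₁ h1 u) = Abelianization.of u := by
    intro s₁ s₂ h1 h2 h12 h
    have hz1 : Abelianization.of z = 1 := by
      rw [← MonoidHom.mem_ker, Abelianization.ker_of]
      exact connectedComponentOfOne_le_commutator h1 h2 h12 (expUnit_mem_connectedComponentOfOne _)
    have hu : Abelianization.of (z * u) = Abelianization.of u := by rw [map_mul, hz1, one_mul]
    rwa [abelianization_map_eq _ hu, hu] at h
  have hw : ¬ IsUnit (((z * u : Aˣ) : A) - 1) := by
    have : ((z * u : Aˣ) : A) - 1 = -(algebraMap ℂ A c⁻¹ * (algebraMap ℂ A c - u)) := by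
      rw [mul_sub, ← map_mul, inv_mul_cancel₀ hc0, map_one, Units.val_mul, hz, neg_sub]
    rw [this, IsUnit.neg_iff, ← hz, Units.isUnit_units_mul]
    exact hc
  -- For non-invertible w, the elements w* w and w w* cannot both be invertible, as w would have
  -- inverses on both sides. So the previous lemma applies to z u or to its adjoint.
  by_cases hcase : IsUnit (star (((z * u : Aˣ) : A) - 1) * (((z * u : Aˣ) : A) - 1))
  · have hcase' : ¬ IsUnit (star (((star (z * u) : Aˣ) : A) - 1) *
        (((star (z * u) : Aˣ) : A) - 1)) := by
      rw [Units.coe_star, star_sub, star_star, star_one]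
      intro h
      rw [← star_one A, ← star_sub, star_one] at h
      refine hw (isUnit_iff_exists_and_exists.2 ⟨?_, ?_⟩)
      · obtain ⟨b, hb⟩ := h.exists_right_inv
        exact ⟨_, (mul_assoc _ _ _).symm.trans hb⟩
      · obtain ⟨b, hb⟩ := hcase.exists_left_inv
        exact ⟨_, (mul_assoc _ _ _).trans hb⟩
    obtain ⟨s₁, s₂, h1, h2, h12, h⟩ := exists_isometries_fixing_of_not_isUnit hA hA' hcase'
    refine ⟨s₁, s₂, h1, h2, h12, hzu s₁ s₂ h1 h2 h12 (abelianization_star_eq ?_)⟩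
    rw [star_isometryUnits, h]
  · obtain ⟨s₁, s₂, h1, h2, h12, h⟩ := exists_isometries_fixing_of_not_isUnit hA hA' hcase
    exact ⟨s₁, s₂, h1, h2, h12, hzu s₁ s₂ h1 h2 h12 h⟩

end Representatives

/-! ### Compressions between matrix algebras of different sizes -/

section RectangularCorners

variable {A : Type*} [CStarAlgebra A]

/-- The corner embedding `x ↦ V x V*` of matrix algebras attached to a rectangular isometry `V`. -/
def rectCorner {m n : ℕ} (V : Matrix (Fin m) (Fin n) A) (hV : Vᴴ * V = 1) :
    Matrix (Fin n) (Fin n) A →ₙ+* Matrix (Fin m) (Fin m) A where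
  toFun x := V * x * Vᴴ
  map_zero' := by simp
  map_add' x y := by simp only [Matrix.mul_add, Matrix.add_mul]
  map_mul' x y := by
    rw [Matrix.mul_assoc (V * x), ← Matrix.mul_assoc Vᴴ, ← Matrix.mul_assoc Vᴴ, hV, Matrix.one_mul]
    simp only [Matrix.mul_assoc]

theorem rectCorner_apply {m n : ℕ} (V : Matrix (Fin m) (Fin n) A) (hV : Vᴴ * V = 1)
    (x : Matrix (Fin n) (Fin n) A) : rectCorner V hV x = V * x * Vᴴ := rfl

/-- The homomorphism `x ↦ V x V* + 1 - V V*` of general linear groups attached to a rectangular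
isometry `V`. -/
def rectUnits {m n : ℕ} (V : Matrix (Fin m) (Fin n) A) (hV : Vᴴ * V = 1) :
    (Matrix (Fin n) (Fin n) A)ˣ →* (Matrix (Fin m) (Fin m) A)ˣ :=
  cornerUnits (rectCorner V hV)

theorem coe_rectUnits {m n : ℕ} (V : Matrix (Fin m) (Fin n) A) (hV : Vᴴ * V = 1)
    (x : (Matrix (Fin n) (Fin n) A)ˣ) :
    (rectUnits V hV x : Matrix (Fin m) (Fin m) A) =
      V * (x : Matrix (Fin n) (Fin n) A) * Vᴴ + (1 - V * Vᴴ) := by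
  rw [rectUnits, coe_cornerUnits, rectCorner_apply, rectCorner_apply, Matrix.mul_one]

theorem continuous_rectUnits {m n : ℕ} (V : Matrix (Fin m) (Fin n) A) (hV : Vᴴ * V = 1) :
    Continuous (rectUnits V hV) :=
  continuous_cornerUnits (by
    change Continuous fun x : Matrix (Fin n) (Fin n) A => V * x * Vᴴ
    fun_prop)

theorem rect_isometry_mul {k m n : ℕ} {W : Matrix (Fin k) (Fin m) A} {V : Matrix (Fin m) (Fin n) A}
    (hW : Wᴴ * W = 1) (hV : Vᴴ * V = 1) : (W * V)ᴴ * (W * V) = 1 := by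
  rw [Matrix.conjTranspose_mul, Matrix.mul_assoc, ← Matrix.mul_assoc Wᴴ, hW, Matrix.one_mul, hV]

theorem rectUnits_rectUnits {k m n : ℕ} {W : Matrix (Fin k) (Fin m) A}
    {V : Matrix (Fin m) (Fin n) A} (hW : Wᴴ * W = 1) (hV : Vᴴ * V = 1)
    (x : (Matrix (Fin n) (Fin n) A)ˣ) :
    rectUnits W hW (rectUnits V hV x) = rectUnits (W * V) (rect_isometry_mul hW hV) x := by
  ext1
  simp only [coe_rectUnits, Matrix.conjTranspose_mul, Matrix.mul_add, Matrix.add_mul,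
    Matrix.mul_sub, Matrix.sub_mul, Matrix.mul_one, Matrix.mul_assoc]
  abel

theorem commute_rectUnits {m n l : ℕ} {V : Matrix (Fin m) (Fin n) A} {W : Matrix (Fin m) (Fin l) A}
    (hV : Vᴴ * V = 1) (hW : Wᴴ * W = 1) (hVW : Vᴴ * W = 0) (x : (Matrix (Fin n) (Fin n) A)ˣ)
    (y : (Matrix (Fin l) (Fin l) A)ˣ) : Commute (rectUnits V hV x) (rectUnits W hW y) := by
  have hWV : Wᴴ * V = 0 := by simpa using congrArg conjTranspose hVW
  have h1 : ∀ {k : ℕ} (z : Matrix (Fin l) (Fin k) A), Vᴴ * (W * z) = 0 := fun z => by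
    rw [← Matrix.mul_assoc, hVW, Matrix.zero_mul]
  have h2 : ∀ {k : ℕ} (z : Matrix (Fin n) (Fin k) A), Wᴴ * (V * z) = 0 := fun z => by
    rw [← Matrix.mul_assoc, hWV, Matrix.zero_mul]
  rw [Commute, SemiconjBy]
  ext1
  rw [Units.val_mul, Units.val_mul, coe_rectUnits, coe_rectUnits]
  simp only [Matrix.mul_add, Matrix.add_mul, Matrix.mul_sub, Matrix.sub_mul, Matrix.mul_one,
    Matrix.one_mul, Matrix.mul_assoc, h1, h2, Matrix.mul_zero]
  abel

/-- The conjugating exchange unit lies in the identity component, so conjugation by it is invisible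
in the quotient. -/
theorem rectUnits_mk_eq {m n : ℕ} {V W : Matrix (Fin m) (Fin n) A}
    (hV : Vᴴ * V = 1) (hW : Wᴴ * W = 1) (hVW : Vᴴ * W = 0) (x : (Matrix (Fin n) (Fin n) A)ˣ) :
    (QuotientGroup.mk (rectUnits W hW x) : (Matrix (Fin m) (Fin m) A)ˣ ⧸ glZero A m) =
      QuotientGroup.mk (rectUnits V hV x) := by
  have hWV : Wᴴ * V = 0 := by simpa using congrArg conjTranspose hVW
  have h : OrthogonalEquiv (rectCorner V hV 1) (W * Vᴴ) (V * Wᴴ) := by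
    constructor <;> simp only [rectCorner_apply, Matrix.mul_one]
    · rw [Matrix.mul_assoc, ← Matrix.mul_assoc Wᴴ, hW, Matrix.one_mul]
    · rw [Matrix.mul_assoc, ← Matrix.mul_assoc Vᴴ, hV, Matrix.one_mul]
    · rw [Matrix.mul_assoc, ← Matrix.mul_assoc Vᴴ, hV, Matrix.one_mul]
    · rw [Matrix.mul_assoc, ← Matrix.mul_assoc Vᴴ, hVW, Matrix.zero_mul, Matrix.mul_zero]
    · rw [Matrix.mul_assoc, ← Matrix.mul_assoc Wᴴ, hWV, Matrix.zero_mul, Matrix.mul_zero]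
  have hc : ∀ a, rectCorner W hW a = W * Vᴴ * rectCorner V hV a * (V * Wᴴ) := fun a => by
    simp only [rectCorner_apply, Matrix.mul_assoc]
    rw [← Matrix.mul_assoc Vᴴ V Wᴴ, hV, Matrix.one_mul, ← Matrix.mul_assoc Vᴴ V, hV, Matrix.one_mul]
  have hz : (QuotientGroup.mk (exchangeUnit _ _ h.sq_zero h.sq_zero') :
      (Matrix (Fin m) (Fin m) A)ˣ ⧸ glZero A m) = 1 :=
    (QuotientGroup.eq_one_iff _).2 (exchangeUnit_mem_connectedComponentOfOne ..)
  rw [rectUnits, h.cornerUnits_conj_eq hc x, QuotientGroup.mk_mul, QuotientGroup.mk_mul,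
    QuotientGroup.mk_inv, hz, one_mul, inv_one, mul_one]
  rfl

/-- The isometry of free modules attached to an injection of index sets. -/
def inclMatrix (A : Type*) [CStarAlgebra A] {m n : ℕ} (f : Fin n → Fin m) :
    Matrix (Fin m) (Fin n) A :=
  (1 : Matrix (Fin m) (Fin m) A).submatrix id f

theorem inclMatrix_conjTranspose_mul {m n l : ℕ} (f : Fin n → Fin m) (g : Fin l → Fin m) :
    (inclMatrix A f)ᴴ * inclMatrix A g = (1 : Matrix (Fin m) (Fin m) A).submatrix f g := by
  rw [inclMatrix, inclMatrix, conjTranspose_submatrix, conjTranspose_one,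
    ← Matrix.submatrix_mul _ _ _ _ _ Function.bijective_id, Matrix.mul_one]

theorem inclMatrix_isometry {m n : ℕ} {f : Fin n → Fin m} (hf : Function.Injective f) :
    (inclMatrix A f)ᴴ * inclMatrix A f = 1 := by
  rw [inclMatrix_conjTranspose_mul, Matrix.submatrix_one _ hf]

theorem inclMatrix_orthogonal {m n l : ℕ} {f : Fin n → Fin m} {g : Fin l → Fin m}
    (hfg : ∀ i j, f i ≠ g j) : (inclMatrix A f)ᴴ * inclMatrix A g = 0 := by
  rw [inclMatrix_conjTranspose_mul]
  ext i j
  simp [hfg i j]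

theorem glPad_eq_rectUnits {m n : ℕ} (h : m ≤ n) (x : (Matrix (Fin m) (Fin m) A)ˣ) :
    glPad h x = rectUnits (inclMatrix A (Fin.castLE h))
      (inclMatrix_isometry (Fin.castLE_injective h)) x := by
  ext1
  rw [coe_rectUnits]
  ext i j
  simp only [glPad, Units.coe_map, MonoidHom.coe_mk, OneHom.coe_mk, padOne, Matrix.of_apply,
    Matrix.add_apply, Matrix.sub_apply, Matrix.mul_apply, Matrix.conjTranspose_apply, inclMatrix,
    Matrix.submatrix_apply, id_eq, Matrix.one_apply]
  by_cases hi : (i : ℕ) < m <;> by_cases hj : (j : ℕ) < m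
  · have e1 : ∀ a : Fin m, i = Fin.castLE h a ↔ ⟨i, hi⟩ = a := fun a => by simp [Fin.ext_iff]
    have e2 : ∀ a : Fin m, j = Fin.castLE h a ↔ ⟨j, hj⟩ = a := fun a => by simp [Fin.ext_iff]
    simp [hi, hj, e1, e2, apply_ite star, Fin.ext_iff (a := i)]
  · have e2 : ∀ a : Fin m, j ≠ Fin.castLE h a := fun a => by
      rw [Ne, Fin.ext_iff]; simp; omega
    simp [hj, e2]
  · have e1 : ∀ a : Fin m, i ≠ Fin.castLE h a := fun a => by
      rw [Ne, Fin.ext_iff]; simp; omega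
    simp [hi, e1]
  · have e1 : ∀ a : Fin m, i ≠ Fin.castLE h a := fun a => by
      rw [Ne, Fin.ext_iff]; simp; omega
    simp [hi, e1]

end RectangularCorners

/-! ### Invariance of K₁ classes under compression, and commutativity -/

section K1Class

variable {A : Type*} [CStarAlgebra A]

/-- The class in `K₁(A)` of an invertible matrix. -/
noncomputable def k1Class (A : Type*) [CStarAlgebra A] (n : ℕ) :
    (Matrix (Fin n) (Fin n) A)ˣ →* K1 A where
  toFun x := ⟦⟨n, QuotientGroup.mk x⟩⟧
  map_one' := (DirectLimit.one_def (f := k1Map A) n).symm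
  map_mul' x y :=
    (DirectLimit.mul_def (f := k1Map A) n (QuotientGroup.mk x) (QuotientGroup.mk y)).symm

theorem k1Class_eq_of_mk_eq {n : ℕ} {x y : (Matrix (Fin n) (Fin n) A)ˣ}
    (h : (QuotientGroup.mk x : (Matrix (Fin n) (Fin n) A)ˣ ⧸ glZero A n) = QuotientGroup.mk y) :
    k1Class A n x = k1Class A n y := by
  change (⟦⟨n, QuotientGroup.mk x⟩⟧ : K1 A) = ⟦⟨n, QuotientGroup.mk y⟩⟧
  rw [h]

theorem exists_k1Class_eq (z : K1 A) : ∃ n x, k1Class A n x = z := by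
  induction z using DirectLimit.induction with
  | _ n x =>
    induction x using QuotientGroup.induction_on with
    | H x => exact ⟨n, x, rfl⟩

theorem k1Class_eq_one_iff {n : ℕ} {x : (Matrix (Fin n) (Fin n) A)ˣ} :
    k1Class A n x = 1 ↔ ∃ m, ∃ h : n ≤ m, glPad h x ∈ glZero A m := by
  refine (DirectLimit.exists_eq_one (f := k1Map A) ⟨n, QuotientGroup.mk x⟩).trans
    (exists_congr fun m => exists_congr fun h => ?_)
  exact QuotientGroup.eq_one_iff (glPad h x)

theorem k1Class_glPad {m n : ℕ} (h : m ≤ n) (x : (Matrix (Fin m) (Fin m) A)ˣ) :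
    k1Class A n (glPad h x) = k1Class A m x := by
  have := DirectLimit.mk_apply (f := k1Map A) m n (QuotientGroup.mk x) h
  exact this

theorem k1Class_rectUnits {m n : ℕ} (V : Matrix (Fin m) (Fin n) A) (hV : Vᴴ * V = 1)
    (x : (Matrix (Fin n) (Fin n) A)ˣ) : k1Class A m (rectUnits V hV x) = k1Class A n x := by
  -- The last m coordinates are disjoint from both the first m and the first n, so either padded
  -- matrix can be compared with a copy of V x V* placed there.
  have hm : m ≤ (m + n) + m := by omega
  have hn : n ≤ (m + n) + m := by omega
  have hW := inclMatrix_isometry (A := A) (Fin.natAdd_injective m (m + n))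
  rw [← k1Class_glPad hm, ← k1Class_glPad hn, glPad_eq_rectUnits, glPad_eq_rectUnits]
  have h1 := rectUnits_mk_eq (inclMatrix_isometry (A := A) (Fin.castLE_injective hm)) hW
    (inclMatrix_orthogonal fun i j => by rw [Ne, Fin.ext_iff]; simp; omega) (rectUnits V hV x)
  rw [← k1Class_eq_of_mk_eq h1, rectUnits_rectUnits]
  refine k1Class_eq_of_mk_eq (rectUnits_mk_eq _ _ ?_ x)
  rw [← Matrix.mul_assoc, inclMatrix_orthogonal fun i j => by rw [Ne, Fin.ext_iff]; simp; omega,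
    Matrix.zero_mul]

/-- The classes are represented by diag(x, 1) and diag(1, y), which commute. -/
theorem k1Class_commute {n : ℕ} (x y : (Matrix (Fin n) (Fin n) A)ˣ) :
    Commute (k1Class A n x) (k1Class A n y) := by
  have hV := inclMatrix_isometry (A := A) (Fin.castAdd_injective n n)
  have hW := inclMatrix_isometry (A := A) (Fin.natAdd_injective n n)
  rw [← k1Class_rectUnits _ hV x, ← k1Class_rectUnits _ hW y]
  exact (commute_rectUnits hV hW
    (inclMatrix_orthogonal fun i j => by rw [Ne, Fin.ext_iff]; simp; omega) x y).map _

end K1Class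

/-! ### K₁ as the abelianization of the invertible group -/

section Comparison

variable {A : Type*} [CStarAlgebra A]

/-- The elements `s₂ ^ j s₁` are isometries with pairwise orthogonal ranges. -/
theorem star_pow_mul_mul {s₁ s₂ : A} (h1 : star s₁ * s₁ = 1) (h2 : star s₂ * s₂ = 1)
    (h12 : star s₁ * s₂ = 0) (i j : ℕ) :
    star (s₂ ^ i * s₁) * (s₂ ^ j * s₁) = if i = j then 1 else 0 := by
  have h21 : star s₂ * s₁ = 0 := by simpa using congrArg star h12
  induction i generalizing j with
  | zero =>
    cases j with
    | zero => simpa using h1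
    | succ j => simp [pow_succ', ← mul_assoc, h12]
  | succ i ih =>
    cases j with
    | zero => rw [pow_succ', mul_assoc, star_mul, mul_assoc]; simp [h21]
    | succ j =>
      rw [pow_succ', pow_succ', mul_assoc, mul_assoc, star_mul_isometry_mul h2, ih]
      simp

/-- The row `(s₁, s₂ s₁, s₂² s₁, …)` of length `n`. -/
def isometryRow (s₁ s₂ : A) (n : ℕ) : Matrix (Fin 1) (Fin n) A :=
  Matrix.of fun _ j => s₂ ^ (j : ℕ) * s₁

theorem isometryRow_isometry {s₁ s₂ : A} (h1 : star s₁ * s₁ = 1) (h2 : star s₂ * s₂ = 1)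
    (h12 : star s₁ * s₂ = 0) (n : ℕ) : (isometryRow s₁ s₂ n)ᴴ * isometryRow s₁ s₂ n = 1 := by
  ext i j
  rw [Matrix.mul_apply, Fin.sum_univ_one, Matrix.conjTranspose_apply]
  simp only [isometryRow, Matrix.of_apply, star_pow_mul_mul h1 h2 h12, Matrix.one_apply,
    Fin.ext_iff]

/-- The identification of the invertible group of `A` with `GL₁(A)`. -/
def glOneEquiv (A : Type*) [CStarAlgebra A] : (Matrix (Fin 1) (Fin 1) A)ˣ ≃* Aˣ :=
  Units.mapEquiv Matrix.uniqueRingEquiv.toMulEquiv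

theorem coe_glOneEquiv (x : (Matrix (Fin 1) (Fin 1) A)ˣ) :
    (glOneEquiv A x : A) = (x : Matrix (Fin 1) (Fin 1) A) 0 0 := rfl

theorem continuous_glOneEquiv : Continuous (glOneEquiv A) :=
  Continuous.units_map _ (continuous_id.matrix_elem 0 0)

theorem glOneEquiv_mem_of_mem_glZero {x : (Matrix (Fin 1) (Fin 1) A)ˣ} (hx : x ∈ glZero A 1) :
    glOneEquiv A x ∈ Subgroup.connectedComponentOfOne Aˣ := by
  have := continuous_glOneEquiv.image_connectedComponent_subset 1 ⟨x, hx, rfl⟩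
  rwa [map_one] at this

/-- The canonical homomorphism from the invertible group to `K₁`. -/
noncomputable def unitsToK1 (A : Type*) [CStarAlgebra A] : Aˣ →* K1 A :=
  (k1Class A 1).comp (glOneEquiv A).symm.toMonoidHom

theorem unitsToK1_glOneEquiv (x : (Matrix (Fin 1) (Fin 1) A)ˣ) :
    unitsToK1 A (glOneEquiv A x) = k1Class A 1 x := by
  simp [unitsToK1]

theorem commutator_le_ker_unitsToK1 : commutator Aˣ ≤ (unitsToK1 A).ker := by
  rw [commutator_def, Subgroup.commutator_le]
  intro u _ w _
  rw [MonoidHom.mem_ker, map_commutatorElement, commutatorElement_eq_one_iff_commute]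
  exact k1Class_commute _ _

theorem unitsToK1_surjective {s₁ s₂ : A} (h1 : star s₁ * s₁ = 1) (h2 : star s₂ * s₂ = 1)
    (h12 : star s₁ * s₂ = 0) : Function.Surjective (unitsToK1 A) := by
  intro z
  obtain ⟨n, x, rfl⟩ := exists_k1Class_eq z
  exact ⟨glOneEquiv A (rectUnits _ (isometryRow_isometry h1 h2 h12 n) x), by
    rw [unitsToK1_glOneEquiv, k1Class_rectUnits]⟩

/-- Triviality in K₁ puts diag(u, 1) in the identity component at some size m. Compressing by the
row of isometries is continuous and returns to A. -/
theorem isometryUnits_mem_of_k1Class_eq_one {s₁ s₂ : A} (h1 : star s₁ * s₁ = 1)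
    (h2 : star s₂ * s₂ = 1) (h12 : star s₁ * s₂ = 0) {u : Aˣ} (hu : unitsToK1 A u = 1) :
    isometryUnits s₁ h1 u ∈ Subgroup.connectedComponentOfOne Aˣ := by
  obtain ⟨x, rfl⟩ := (glOneEquiv A).surjective u
  rw [unitsToK1_glOneEquiv, k1Class_eq_one_iff] at hu
  obtain ⟨m, hm, hx⟩ := hu
  have hrow := isometryRow_isometry h1 h2 h12 m
  have hmem : rectUnits _ hrow (glPad hm x) ∈ glZero A 1 := by
    have := (continuous_rectUnits _ hrow).image_connectedComponent_subset 1 ⟨_, hx, rfl⟩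
    rwa [map_one] at this
  convert glOneEquiv_mem_of_mem_glZero hmem using 1
  ext
  rw [glPad_eq_rectUnits, rectUnits_rectUnits, coe_isometryUnits, coe_glOneEquiv, coe_glOneEquiv,
    coe_rectUnits]
  -- Only the first entry of the row, s₂⁰ s₁ = s₁, meets the block containing u.
  have hrow0 : (isometryRow s₁ s₂ m * inclMatrix A (Fin.castLE hm)) 0 0 = s₁ := by
    simp [Matrix.mul_apply, isometryRow, inclMatrix, Matrix.one_apply]
  generalize isometryRow s₁ s₂ m * inclMatrix A (Fin.castLE hm) = V at hrow0 ⊢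
  simp [Matrix.mul_apply, hrow0]

/-- For a purely infinite simple C*-algebra, `K₁` is the abelianization of the invertible group. -/
theorem ker_unitsToK1 (hA : IsSimpleCStarAlgebra A) (hA' : IsPurelyInfinite A) :
    (unitsToK1 A).ker = commutator Aˣ := by
  refine le_antisymm (fun u hu => ?_) commutator_le_ker_unitsToK1
  obtain ⟨s₁, s₂, h1, h2, h12, h⟩ := exists_isometries_fixing hA hA' u
  have := connectedComponentOfOne_le_commutator h1 h2 h12
    (isometryUnits_mem_of_k1Class_eq_one h1 h2 h12 hu)
  rw [← Abelianization.ker_of, MonoidHom.mem_ker] at this ⊢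
  rw [← h, this]

theorem nonempty_abelianization_mulEquiv_K1 (hA : IsSimpleCStarAlgebra A)
    (hA' : IsPurelyInfinite A) : Nonempty (Abelianization Aˣ ≃* K1 A) := by
  obtain ⟨s₁, s₂, h1, h2, h12, -⟩ := exists_isometries_fixing hA hA' 1
  exact ⟨(QuotientGroup.quotientMulEquivOfEq (ker_unitsToK1 hA hA').symm).trans
    (QuotientGroup.quotientKerEquivOfSurjective _ (unitsToK1_surjective h1 h2 h12))⟩

end Comparison

theorem theorem5p5 {A : Type*} {B : Type*} [CStarAlgebra A] [CStarAlgebra B]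
    (hA : IsSimpleCStarAlgebra A) (hB : IsSimpleCStarAlgebra B)
    (hA' : IsPurelyInfinite A) (hB' : IsPurelyInfinite B)
    (hGL : Nonempty (Aˣ ≃* Bˣ)) :
    Nonempty (K1 A ≃* K1 B) := by
  obtain ⟨e⟩ := hGL
  obtain ⟨f⟩ := nonempty_abelianization_mulEquiv_K1 hA hA'
  obtain ⟨g⟩ := nonempty_abelianization_mulEquiv_K1 hB hB'
  exact ⟨(f.symm.trans e.abelianizationCongr).trans g⟩
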